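/- Let $R\subseteq\mathbb{R}^3$ be a simply connected region (a nonempty open set that is path-connected and in which every loop is null-homotopic), with points written $(x,y,y')$, where $y'$ is treated as an independent variable. Let $a_2,a_1,a_0$ be continuous real-valued functions on $R$ such that the partial derivatives $$\frac{\partial a_2}{\partial y},\quad \frac{\partial a_2}{\partial x},\quad \frac{\partial a_1}{\partial x},\quad \frac{\partial a_1}{\partial y'},\quad \frac{\partial a_0}{\partial y'},\quad \frac{\partial a_0}{\partial y}$$ exist and are continuous on $R$. The differential equation $$a_2(x,y,y')\,y''+a_1(x,y,y')\,y'+a_0(x,y,y')=0$$ is called exact on $R$ if there is a function $\Psi:R\to\mathbb{R}$ whose first partial derivatives exist on $R$ and satisfy $$\frac{\partial\Psi}{\partial x}=a_0,\qquad \frac{\partial\Psi}{\partial y}=a_1,\qquad \frac{\partial\Psi}{\partial y'}=a_2\qquad\text{on } R.$$ Then the equation is exact on $R$ if and only if $$\frac{\partial a_2}{\partial y}=\frac{\partial a_1}{\partial y'},\qquad \frac{\partial a_2}{\partial x}=\frac{\partial a_0}{\partial y'},\qquad \frac{\partial a_1}{\partial x}=\frac{\partial a_0}{\partial y}\qquad\text{on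 } R.$$ -/

import Mathlib

/-! Points of `ℝ³` are triples `(x, y, p) : ℝ × ℝ × ℝ`, where the third coordinate `p` is the
independent variable written `y'` in the differential equation. -/

/-- The slice of `f` through `q` in the `x`-direction, as a function of `x`. -/
def sliceX (f : ℝ × ℝ × ℝ → ℝ) (q : ℝ × ℝ × ℝ) : ℝ → ℝ := fun t => f (t, q.2.1, q.2.2)

/-- The slice of `f` through `q` in the `y`-direction, as a function of `y`. -/
def sliceY (f : ℝ × ℝ × ℝ → ℝ) (q : ℝ × ℝ × ℝ) : ℝ → ℝ := fun t => f (q.1, t, q.2.2)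

/-- The slice of `f` through `q` in the `y'`-direction, as a function of `y'`. -/
def sliceP (f : ℝ × ℝ × ℝ → ℝ) (q : ℝ × ℝ × ℝ) : ℝ → ℝ := fun t => f (q.1, q.2.1, t)

/-- The partial derivative `∂f/∂x`. -/
noncomputable def partialX (f : ℝ × ℝ × ℝ → ℝ) (q : ℝ × ℝ × ℝ) : ℝ := deriv (sliceX f q) q.1

/-- The partial derivative `∂f/∂y`. -/
noncomputable def partialY (f : ℝ × ℝ × ℝ → ℝ) (q : ℝ × ℝ × ℝ) : ℝ := deriv (sliceY f q) q.2.1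

/-- The partial derivative `∂f/∂y'`. -/
noncomputable def partialP (f : ℝ × ℝ × ℝ → ℝ) (q : ℝ × ℝ × ℝ) : ℝ := deriv (sliceP f q) q.2.2

/-- `∂f/∂x` exists at every point of `R` and is (jointly) continuous on `R`. -/
def HasContPartialX (f : ℝ × ℝ × ℝ → ℝ) (R : Set (ℝ × ℝ × ℝ)) : Prop :=
  (∀ q ∈ R, DifferentiableAt ℝ (sliceX f q) q.1) ∧ ContinuousOn (partialX f) R

/-- `∂f/∂y` exists at every point of `R` and is (jointly) continuous on `R`. -/
def HasContPartialY (f : ℝ × ℝ × ℝ → ℝ) (R : Set (ℝ × ℝ × ℝ)) : Prop :=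
  (∀ q ∈ R, DifferentiableAt ℝ (sliceY f q) q.2.1) ∧ ContinuousOn (partialY f) R

/-- `∂f/∂y'` exists at every point of `R` and is (jointly) continuous on `R`. -/
def HasContPartialP (f : ℝ × ℝ × ℝ → ℝ) (R : Set (ℝ × ℝ × ℝ)) : Prop :=
  (∀ q ∈ R, DifferentiableAt ℝ (sliceP f q) q.2.2) ∧ ContinuousOn (partialP f) R

/-- The equation `a₂(x,y,y') y'' + a₁(x,y,y') y' + a₀(x,y,y') = 0` is exact on `R`: there is a
function `Ψ` whose partial derivatives exist on `R` and satisfy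
`∂Ψ/∂x = a₀`, `∂Ψ/∂y = a₁`, `∂Ψ/∂y' = a₂` there. -/
def IsExactEquationOn (a₂ a₁ a₀ : ℝ × ℝ × ℝ → ℝ) (R : Set (ℝ × ℝ × ℝ)) : Prop :=
  ∃ Ψ : ℝ × ℝ × ℝ → ℝ, ∀ q ∈ R,
    HasDerivAt (sliceX Ψ q) (a₀ q) q.1 ∧
    HasDerivAt (sliceY Ψ q) (a₁ q) q.2.1 ∧
    HasDerivAt (sliceP Ψ q) (a₂ q) q.2.2

open Set Filter Topology

/-! Necessity is the symmetry of mixed partials of a potential (`mixed_partial_eq`). Sufficiency is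
the Poincaré lemma in degree one: on a box, integrating along an axis-parallel path gives a
potential (`exists_hasPartialsAt_of_box`), and two local potentials differ by a locally constant
function. These differences are the transition functions of a bundle with discrete fibre, hence of a
covering; over a simply connected base it has a global section, which glues the local potentials
(`exists_global_of_eventually_sub_eq`). -/

theorem tendsto_second_difference {f fx fxy : ℝ → ℝ → ℝ} {x y : ℝ} {s : Set (ℝ × ℝ)}
    (hs : s ∈ 𝓝 (x, y))
    (hfx : ∀ u v, (u, v) ∈ s → HasDerivAt (fun t => f t v) (fx u v) u)
    (hfxy : ∀ u v, (u, v) ∈ s → HasDerivAt (fun t => fx u t) (fxy u v) v)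
    (hc : ContinuousAt (Function.uncurry fxy) (x, y)) :
    Tendsto (fun h => (f (x + h) (y + h) - f (x + h) y - f x (y + h) + f x y) / h / h)
      (𝓝[>] 0) (𝓝 (fxy x y)) := by
  rw [Metric.tendsto_nhds]
  intro ε hε
  have hc' : ∀ᶠ q in 𝓝 (x, y), dist (Function.uncurry fxy q) (fxy x y) < ε :=
    Metric.tendsto_nhds.1 hc ε hε
  obtain ⟨δ, hδ, hball⟩ := Metric.eventually_nhds_iff.1 (hc'.and hs)
  have hnear : ∀ h, 0 < h → h < δ → ∀ u ∈ Icc x (x + h), ∀ v ∈ Icc y (y + h),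
      dist (u, v) (x, y) < δ := by
    intro h h0 hh u hu v hv
    rw [Prod.dist_eq, max_lt_iff, Real.dist_eq, Real.dist_eq, abs_lt, abs_lt]
    simp only [mem_Icc] at hu hv
    refine ⟨⟨?_, ?_⟩, ?_, ?_⟩ <;> simp only <;> linarith
  filter_upwards [Ioo_mem_nhdsGT hδ] with h hh
  have h0 : 0 < h := hh.1
  have hmem : ∀ u ∈ Icc x (x + h), ∀ v ∈ Icc y (y + h), (u, v) ∈ s := fun u hu v hv =>
    (hball (hnear h h0 hh.2 u hu v hv)).2
  have hxl : x ≤ x + h := by linarith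
  have hyl : y ≤ y + h := by linarith
  have hd : ∀ u ∈ Icc x (x + h),
      HasDerivAt (fun t => f t (y + h) - f t y) (fx u (y + h) - fx u y) u := fun u hu =>
    (hfx u _ (hmem u hu _ (right_mem_Icc.2 hyl))).sub (hfx u _ (hmem u hu _ (left_mem_Icc.2 hyl)))
  -- Two uses of the mean value theorem turn the quotient into `fxy ξ η` at a point of the square.
  obtain ⟨ξ, hξ, hξe⟩ := exists_hasDerivAt_eq_slope (fun t => f t (y + h) - f t y)
    (fun u => fx u (y + h) - fx u y) (by linarith : x < x + h)
    (fun u hu => (hd u hu).continuousAt.continuousWithinAt)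
    (fun u hu => hd u (Ioo_subset_Icc_self hu))
  have hξ' := Ioo_subset_Icc_self hξ
  obtain ⟨η, hη, hηe⟩ := exists_hasDerivAt_eq_slope (fun t => fx ξ t) (fun v => fxy ξ v)
    (by linarith : y < y + h)
    (fun v hv => (hfxy ξ v (hmem ξ hξ' v hv)).continuousAt.continuousWithinAt)
    (fun v hv => hfxy ξ v (hmem ξ hξ' v (Ioo_subset_Icc_self hv)))
  have hval : (f (x + h) (y + h) - f (x + h) y - f x (y + h) + f x y) / h / h = fxy ξ η := by
    simp only [add_sub_cancel_left] at hξe hηe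
    rw [hηe, hξe]
    ring
  rw [hval]
  exact (hball (hnear h h0 hh.2 ξ hξ' η (Ioo_subset_Icc_self hη))).1

/-- Equality of mixed partial derivatives, assuming only that both of them exist near the point
and are continuous at it. -/
theorem mixed_partial_eq {f fx fy fxy fyx : ℝ → ℝ → ℝ} {x y : ℝ} {s : Set (ℝ × ℝ)}
    (hs : s ∈ 𝓝 (x, y))
    (hfx : ∀ u v, (u, v) ∈ s → HasDerivAt (fun t => f t v) (fx u v) u)
    (hfy : ∀ u v, (u, v) ∈ s → HasDerivAt (fun t => f u t) (fy u v) v)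
    (hfxy : ∀ u v, (u, v) ∈ s → HasDerivAt (fun t => fx u t) (fxy u v) v)
    (hfyx : ∀ u v, (u, v) ∈ s → HasDerivAt (fun t => fy t v) (fyx u v) u)
    (hc : ContinuousAt (Function.uncurry fxy) (x, y))
    (hc' : ContinuousAt (Function.uncurry fyx) (x, y)) : fxy x y = fyx x y := by
  have h₁ := tendsto_second_difference hs hfx hfxy hc
  have hswap : Tendsto Prod.swap (𝓝 (y, x)) (𝓝 (x, y)) := continuous_swap.tendsto (y, x)
  -- The second difference is symmetric in the two variables, so one quotient has both limits.
  have h₂ := tendsto_second_difference (f := fun v u => f u v) (fx := fun v u => fy u v)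
    (fxy := fun v u => fyx u v) (x := y) (y := x) (hswap hs)
    (fun v u h => hfy u v h) (fun v u h => hfyx u v h)
    (ContinuousAt.comp (f := Prod.swap) (g := Function.uncurry fyx) hc' hswap)
  refine tendsto_nhds_unique h₁ (h₂.congr fun h => ?_)
  ring

theorem hasDerivAt_integral_of_continuousOn_prod {G G' : ℝ → ℝ → ℝ} {s : Set ℝ} {a b x : ℝ}
    (hs : s ∈ 𝓝 x)
    (hG : ContinuousOn (Function.uncurry G) (s ×ˢ uIcc a b))
    (hG' : ContinuousOn (Function.uncurry G') (s ×ˢ uIcc a b))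
    (hd : ∀ u ∈ s, ∀ t ∈ uIcc a b, HasDerivAt (fun v => G v t) (G' u t) u) :
    HasDerivAt (fun u => ∫ t in a..b, G u t) (∫ t in a..b, G' x t) x := by
  obtain ⟨δ, hδ, hball⟩ := Metric.nhds_basis_closedBall.mem_iff.1 hs
  have slice : ∀ {H : ℝ → ℝ → ℝ}, ContinuousOn (Function.uncurry H) (s ×ˢ uIcc a b) →
      ∀ u ∈ s, ContinuousOn (H u) (uIcc a b) := fun {H} hH u hu =>
    hH.comp (f := fun t => (u, t)) (by fun_prop) (fun t ht => ⟨hu, ht⟩)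
  have hx : x ∈ s := mem_of_mem_nhds hs
  have hcpt := (isCompact_closedBall x δ).prod (isCompact_uIcc (a := a) (b := b))
  -- Compactness supplies a constant dominating function.
  obtain ⟨C, hC⟩ := hcpt.exists_bound_of_continuousOn
    (hG'.mono (prod_mono_left hball))
  have meas : ∀ {g : ℝ → ℝ}, ContinuousOn g (uIcc a b) → MeasureTheory.AEStronglyMeasurable g
      (MeasureTheory.volume.restrict (uIoc a b)) := fun hg =>
    (hg.mono uIoc_subset_uIcc).aestronglyMeasurable measurableSet_uIoc
  refine (intervalIntegral.hasDerivAt_integral_of_dominated_loc_of_deriv_le (bound := fun _ => C)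
    (Metric.closedBall_mem_nhds x hδ) ?_ (slice hG x hx).intervalIntegrable
    (meas (slice hG' x hx)) ?_ intervalIntegrable_const ?_).2
  · filter_upwards [hs] with u hu using meas (slice hG u hu)
  · exact .of_forall fun t ht u hu => hC (u, t) ⟨hu, uIoc_subset_uIcc ht⟩
  · exact .of_forall fun t ht u hu => hd u (hball hu) t (uIoc_subset_uIcc ht)

theorem hasDerivAt_integral_right_of_continuousOn {g : ℝ → ℝ} {s : Set ℝ} {a x : ℝ}
    (hs : IsOpen s) [s.OrdConnected] (ha : a ∈ s) (hx : x ∈ s) (hg : ContinuousOn g s) :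
    HasDerivAt (fun u => ∫ t in a..u, g t) (g x) x :=
  intervalIntegral.integral_hasDerivAt_right
    (hg.mono (OrdConnected.uIcc_subset ‹_› ha hx)).intervalIntegrable
    (hg.stronglyMeasurableAtFilter hs x hx) (hg.continuousAt (hs.mem_nhds hx))

/-! ### Gluing by covering space theory -/

/-- A family of functions on an open cover of a simply connected space whose differences are
locally constant comes, up to locally constant functions, from one global function. -/
theorem exists_global_of_eventually_sub_eq {X ι G : Type*} [TopologicalSpace X]
    [SimplyConnectedSpace X] [LocallyPathConnectedSpace X] [AddCommGroup G]
    (U : ι → Set X) (hU : ∀ i, IsOpen (U i)) (ind : X → ι) (hind : ∀ x, x ∈ U (ind x))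
    (f : ι → X → G)
    (hf : ∀ i j, ∀ x ∈ U i ∩ U j, ∀ᶠ z in 𝓝 x, f i z - f j z = f i x - f j x) :
    ∃ g : X → G, ∀ i, ∀ x ∈ U i, ∀ᶠ z in 𝓝 x, g z - f i z = g x - f i x := by
  let _ : TopologicalSpace G := ⊥
  have : DiscreteTopology G := ⟨rfl⟩
  let Z : FiberBundleCore ι X G :=
    { baseSet := U
      isOpen_baseSet := hU
      indexAt := ind
      mem_baseSet_at := hind
      -- A coordinate `v` in chart `i` encodes the value `v + f i x`, which must not depend on the
      -- chart.
      coordChange := fun i j x v => v + (f i x - f j x)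
      coordChange_self := fun i x _ v => by simp
      continuousOn_coordChange := by
        intro i j p hp
        refine ContinuousAt.continuousWithinAt ?_
        refine ContinuousAt.add continuousAt_snd ?_
        refine (continuousAt_const (y := f i p.1 - f j p.1)).congr ?_
        filter_upwards [continuousAt_fst.eventually (hf i j p.1 hp.1)] with q hq using hq.symm
      coordChange_comp := fun i j k x _ v => by abel }
  have hcov : IsCoveringMap (Bundle.TotalSpace.proj : Bundle.TotalSpace G Z.Fiber → X) :=
    FiberBundle.isCoveringMap
  obtain ⟨x₀⟩ : Nonempty X := inferInstance
  -- A lift of the identity is a global section.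
  obtain ⟨S, ⟨-, hS⟩, -⟩ := hcov.existsUnique_continuousMap_lifts (ContinuousMap.id X) x₀
    ⟨x₀, (0 : G)⟩ rfl
  have hproj : ∀ x, (S x).1 = x := fun x => congrFun hS x
  let c : X → G := fun x => (S x).2
  refine ⟨fun x => c x + f (ind x) x, fun i x hx => ?_⟩
  -- The chart `ind z` may jump with `z`; in the fixed chart `i` the section is continuous into a
  -- discrete fibre, hence locally constant.
  have hcont : ContinuousAt (fun z => (Z.localTriv i (S z)).2) x := by
    refine continuousAt_snd.comp ?_
    refine ContinuousAt.comp (g := Z.localTriv i) ?_ S.continuous.continuousAt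
    refine (Z.localTriv i).toOpenPartialHomeomorph.continuousAt ?_
    rw [FiberBundleCore.mem_localTriv_source]
    show (S x).1 ∈ U i
    rwa [hproj]
  have hev : ∀ᶠ z in 𝓝 x, (Z.localTriv i (S z)).2 = (Z.localTriv i (S x)).2 := by
    rw [ContinuousAt, nhds_discrete G, tendsto_pure] at hcont
    exact hcont
  have hval : ∀ z, (Z.localTriv i (S z)).2 = c z + f (ind z) z - f i z := by
    intro z
    show c z + (f (ind (S z).1) (S z).1 - f i (S z).1) = _
    rw [hproj, add_sub_assoc]
  filter_upwards [hev] with z hz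
  rwa [hval, hval] at hz

/-! ### Local potentials -/

/-- The partial derivatives of `Ψ` at `q` are `a₀ q`, `a₁ q`, `a₂ q`. -/
def HasPartialsAt (Ψ a₂ a₁ a₀ : ℝ × ℝ × ℝ → ℝ) (q : ℝ × ℝ × ℝ) : Prop :=
  HasDerivAt (sliceX Ψ q) (a₀ q) q.1 ∧
    HasDerivAt (sliceY Ψ q) (a₁ q) q.2.1 ∧
    HasDerivAt (sliceP Ψ q) (a₂ q) q.2.2

theorem HasContPartialX.hasDerivAt {f : ℝ × ℝ × ℝ → ℝ} {R : Set (ℝ × ℝ × ℝ)}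
    (h : HasContPartialX f R) {x y p : ℝ} (hq : (x, y, p) ∈ R) :
    HasDerivAt (fun t => f (t, y, p)) (partialX f (x, y, p)) x :=
  (h.1 _ hq).hasDerivAt

theorem HasContPartialY.hasDerivAt {f : ℝ × ℝ × ℝ → ℝ} {R : Set (ℝ × ℝ × ℝ)}
    (h : HasContPartialY f R) {x y p : ℝ} (hq : (x, y, p) ∈ R) :
    HasDerivAt (fun t => f (x, t, p)) (partialY f (x, y, p)) y :=
  (h.1 _ hq).hasDerivAt

theorem HasContPartialP.hasDerivAt {f : ℝ × ℝ × ℝ → ℝ} {R : Set (ℝ × ℝ × ℝ)}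
    (h : HasContPartialP f R) {x y p : ℝ} (hq : (x, y, p) ∈ R) :
    HasDerivAt (fun t => f (x, y, t)) (partialP f (x, y, p)) p :=
  (h.1 _ hq).hasDerivAt

theorem HasPartialsAt.sub {Ψ Φ a₂ a₁ a₀ b₂ b₁ b₀ : ℝ × ℝ × ℝ → ℝ} {q : ℝ × ℝ × ℝ}
    (h : HasPartialsAt Ψ a₂ a₁ a₀ q) (h' : HasPartialsAt Φ b₂ b₁ b₀ q) :
    HasPartialsAt (Ψ - Φ) (a₂ - b₂) (a₁ - b₁) (a₀ - b₀) q :=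
  ⟨h.1.sub h'.1, h.2.1.sub h'.2.1, h.2.2.sub h'.2.2⟩

theorem HasPartialsAt.congr_of_eventually_sub_eq {Ψ Φ a₂ a₁ a₀ : ℝ × ℝ × ℝ → ℝ} {q : ℝ × ℝ × ℝ}
    (h : HasPartialsAt Φ a₂ a₁ a₀ q) {c : ℝ} (he : ∀ᶠ z in 𝓝 q, Ψ z - Φ z = c) :
    HasPartialsAt Ψ a₂ a₁ a₀ q := by
  have key : ∀ {e : ℝ → ℝ × ℝ × ℝ} {t d : ℝ}, Continuous e → e t = q →
      HasDerivAt (fun s => Φ (e s)) d t → HasDerivAt (fun s => Ψ (e s)) d t := by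
    intro e t d hcont het hd
    refine (hd.add_const c).congr_of_eventuallyEq ?_
    have ht : Tendsto e (𝓝 t) (𝓝 q) := het ▸ hcont.tendsto t
    filter_upwards [ht.eventually he] with s hs
    show Ψ (e s) = Φ (e s) + c
    linarith
  exact ⟨key (e := fun t => (t, q.2.1, q.2.2)) (by fun_prop) rfl h.1,
    key (e := fun t => (q.1, t, q.2.2)) (by fun_prop) rfl h.2.1,
    key (e := fun t => (q.1, q.2.1, t)) (by fun_prop) rfl h.2.2⟩

/-- The product metric is the sup metric, so balls are boxes. -/
theorem ball_eq_prod (c : ℝ × ℝ × ℝ) (r : ℝ) :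
    Metric.ball c r = Metric.ball c.1 r ×ˢ Metric.ball c.2.1 r ×ˢ Metric.ball c.2.2 r := by
  rw [ball_prod_same, ball_prod_same]

theorem eq_of_hasDerivAt_zero {f : ℝ → ℝ} {s : Set ℝ} (hs : IsOpen s) (hc : Convex ℝ s)
    (hd : ∀ t ∈ s, HasDerivAt f 0 t) {u v : ℝ} (hu : u ∈ s) (hv : v ∈ s) : f u = f v :=
  hs.is_const_of_deriv_eq_zero hc.isPreconnected
    (fun t ht => (hd t ht).differentiableAt.differentiableWithinAt)
    (fun t ht => (hd t ht).deriv) hu hv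

/-- Inside a box, `q` is reached by changing one coordinate at a time, so partial derivatives
suffice. -/
theorem eventually_eq_of_hasPartialsAt_zero {D : ℝ × ℝ × ℝ → ℝ} {q : ℝ × ℝ × ℝ}
    (h : ∀ᶠ z in 𝓝 q, HasPartialsAt D 0 0 0 z) : ∀ᶠ z in 𝓝 q, D z = D q := by
  obtain ⟨δ, hδ, hball⟩ := Metric.eventually_nhds_iff_ball.1 h
  obtain ⟨x₀, y₀, p₀⟩ := q
  rw [ball_eq_prod] at hball
  refine Metric.eventually_nhds_iff_ball.2 ⟨δ, hδ, ?_⟩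
  rw [ball_eq_prod]
  rintro ⟨x, y, p⟩ ⟨hx, hy, hp⟩
  simp only at hx hy hp
  have hx₀ := Metric.mem_ball_self (x := x₀) hδ
  have hy₀ := Metric.mem_ball_self (x := y₀) hδ
  calc D (x, y, p) = D (x₀, y, p) :=
        eq_of_hasDerivAt_zero (f := fun t => D (t, y, p)) Metric.isOpen_ball (convex_ball x₀ δ)
          (fun t ht => (hball (t, y, p) ⟨ht, hy, hp⟩).1) hx hx₀
    _ = D (x₀, y₀, p) :=
        eq_of_hasDerivAt_zero (f := fun t => D (x₀, t, p)) Metric.isOpen_ball (convex_ball y₀ δ)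
          (fun t ht => (hball (x₀, t, p) ⟨hx₀, ht, hp⟩).2.1) hy hy₀
    _ = D (x₀, y₀, p₀) :=
        eq_of_hasDerivAt_zero (f := fun t => D (x₀, y₀, t)) Metric.isOpen_ball (convex_ball p₀ δ)
          (fun t ht => (hball (x₀, y₀, t) ⟨hx₀, hy₀, ht⟩).2.2) hp (Metric.mem_ball_self hδ)

/-- A closed system of coefficients on a box has a potential there. -/
theorem exists_hasPartialsAt_of_box {A B C : Set ℝ} (hA : IsOpen A) (hB : IsOpen B) (hC : IsOpen C)
    [A.OrdConnected] [B.OrdConnected] [C.OrdConnected]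
    {x₀ y₀ p₀ : ℝ} (hx₀ : x₀ ∈ A) (hy₀ : y₀ ∈ B) (hp₀ : p₀ ∈ C)
    {R : Set (ℝ × ℝ × ℝ)} (hR : A ×ˢ B ×ˢ C ⊆ R) {a₂ a₁ a₀ : ℝ × ℝ × ℝ → ℝ}
    (ha₂ : ContinuousOn a₂ R) (ha₁ : ContinuousOn a₁ R) (ha₀ : ContinuousOn a₀ R)
    (ha₂y : HasContPartialY a₂ R) (ha₂x : HasContPartialX a₂ R)
    (ha₁x : HasContPartialX a₁ R) (ha₁p : HasContPartialP a₁ R)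
    (ha₀p : HasContPartialP a₀ R) (ha₀y : HasContPartialY a₀ R)
    (hcl : ∀ q ∈ R, partialY a₂ q = partialP a₁ q ∧ partialX a₂ q = partialP a₀ q ∧
      partialX a₁ q = partialY a₀ q) :
    ∃ Ψ : ℝ × ℝ × ℝ → ℝ, ∀ q ∈ A ×ˢ B ×ˢ C, HasPartialsAt Ψ a₂ a₁ a₀ q := by
  have mem : ∀ {x y p : ℝ}, x ∈ A → y ∈ B → p ∈ C → (x, y, p) ∈ R := fun hx hy hp =>
    hR ⟨hx, hy, hp⟩
  have segB : ∀ {y}, y ∈ B → uIcc y₀ y ⊆ B := fun hy => OrdConnected.uIcc_subset ‹_› hy₀ hy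
  have segC : ∀ {p}, p ∈ C → uIcc p₀ p ⊆ C := fun hp => OrdConnected.uIcc_subset ‹_› hp₀ hp
  refine ⟨fun q => (∫ t in x₀..q.1, a₀ (t, y₀, p₀)) + (∫ t in y₀..q.2.1, a₁ (q.1, t, p₀)) +
    ∫ t in p₀..q.2.2, a₂ (q.1, q.2.1, t), ?_⟩
  rintro ⟨x, y, p⟩ ⟨hx, hy, hp⟩
  simp only at hx hy hp
  refine ⟨?_, ?_, ?_⟩
  · have h₀ : HasDerivAt (fun u => ∫ t in x₀..u, a₀ (t, y₀, p₀)) (a₀ (x, y₀, p₀)) x :=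
      hasDerivAt_integral_right_of_continuousOn (g := fun t => a₀ (t, y₀, p₀)) hA hx₀ hx
        (ha₀.comp (by fun_prop) fun t ht => mem ht hy₀ hp₀)
    have h₁ : HasDerivAt (fun u => ∫ t in y₀..y, a₁ (u, t, p₀))
        (∫ t in y₀..y, partialX a₁ (x, t, p₀)) x :=
      hasDerivAt_integral_of_continuousOn_prod (G := fun u t => a₁ (u, t, p₀))
        (G' := fun u t => partialX a₁ (u, t, p₀)) (hA.mem_nhds hx)
        (ha₁.comp (f := fun z : ℝ × ℝ => (z.1, z.2, p₀)) (by fun_prop)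
          fun z hz => mem hz.1 (segB hy hz.2) hp₀)
        (ha₁x.2.comp (f := fun z : ℝ × ℝ => (z.1, z.2, p₀)) (by fun_prop)
          fun z hz => mem hz.1 (segB hy hz.2) hp₀)
        (fun u hu t ht => ha₁x.hasDerivAt (mem hu (segB hy ht) hp₀))
    have h₂ : HasDerivAt (fun u => ∫ t in p₀..p, a₂ (u, y, t))
        (∫ t in p₀..p, partialX a₂ (x, y, t)) x :=
      hasDerivAt_integral_of_continuousOn_prod (G := fun u t => a₂ (u, y, t))
        (G' := fun u t => partialX a₂ (u, y, t)) (hA.mem_nhds hx)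
        (ha₂.comp (f := fun z : ℝ × ℝ => (z.1, y, z.2)) (by fun_prop)
          fun z hz => mem hz.1 hy (segC hp hz.2))
        (ha₂x.2.comp (f := fun z : ℝ × ℝ => (z.1, y, z.2)) (by fun_prop)
          fun z hz => mem hz.1 hy (segC hp hz.2))
        (fun u hu t ht => ha₂x.hasDerivAt (mem hu hy (segC hp ht)))
    have e₁ : ∫ t in y₀..y, partialX a₁ (x, t, p₀) = a₀ (x, y, p₀) - a₀ (x, y₀, p₀) :=
      intervalIntegral.integral_eq_sub_of_hasDerivAt (f := fun t => a₀ (x, t, p₀))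
        (fun t ht => by
          rw [(hcl _ (mem hx (segB hy ht) hp₀)).2.2]
          exact ha₀y.hasDerivAt (mem hx (segB hy ht) hp₀))
        (ha₁x.2.comp (f := fun t => (x, t, p₀)) (by fun_prop)
          fun t ht => mem hx (segB hy ht) hp₀).intervalIntegrable
    have e₂ : ∫ t in p₀..p, partialX a₂ (x, y, t) = a₀ (x, y, p) - a₀ (x, y, p₀) :=
      intervalIntegral.integral_eq_sub_of_hasDerivAt (f := fun t => a₀ (x, y, t))
        (fun t ht => by
          rw [(hcl _ (mem hx hy (segC hp ht))).2.1]
          exact ha₀p.hasDerivAt (mem hx hy (segC hp ht)))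
        (ha₂x.2.comp (f := fun t => (x, y, t)) (by fun_prop)
          fun t ht => mem hx hy (segC hp ht)).intervalIntegrable
    -- By closedness the last two integrals are increments of `a₀`, and the sum telescopes.
    refine ((h₀.add h₁).add h₂).congr_deriv ?_
    rw [e₁, e₂]
    ring
  · have h₁ : HasDerivAt (fun u => ∫ t in y₀..u, a₁ (x, t, p₀)) (a₁ (x, y, p₀)) y :=
      hasDerivAt_integral_right_of_continuousOn (g := fun t => a₁ (x, t, p₀)) hB hy₀ hy
        (ha₁.comp (by fun_prop) fun t ht => mem hx ht hp₀)
    have h₂ : HasDerivAt (fun u => ∫ t in p₀..p, a₂ (x, u, t))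
        (∫ t in p₀..p, partialY a₂ (x, y, t)) y :=
      hasDerivAt_integral_of_continuousOn_prod (G := fun u t => a₂ (x, u, t))
        (G' := fun u t => partialY a₂ (x, u, t)) (hB.mem_nhds hy)
        (ha₂.comp (f := fun z : ℝ × ℝ => (x, z.1, z.2)) (by fun_prop)
          fun z hz => mem hx hz.1 (segC hp hz.2))
        (ha₂y.2.comp (f := fun z : ℝ × ℝ => (x, z.1, z.2)) (by fun_prop)
          fun z hz => mem hx hz.1 (segC hp hz.2))
        (fun u hu t ht => ha₂y.hasDerivAt (mem hx hu (segC hp ht)))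
    have e₂ : ∫ t in p₀..p, partialY a₂ (x, y, t) = a₁ (x, y, p) - a₁ (x, y, p₀) :=
      intervalIntegral.integral_eq_sub_of_hasDerivAt (f := fun t => a₁ (x, y, t))
        (fun t ht => by
          rw [(hcl _ (mem hx hy (segC hp ht))).1]
          exact ha₁p.hasDerivAt (mem hx hy (segC hp ht)))
        (ha₂y.2.comp (f := fun t => (x, y, t)) (by fun_prop)
          fun t ht => mem hx hy (segC hp ht)).intervalIntegrable
    refine ((h₁.const_add (∫ t in x₀..x, a₀ (t, y₀, p₀))).add h₂).congr_deriv ?_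
    rw [e₂]
    ring
  · have h₂ : HasDerivAt (fun u => ∫ t in p₀..u, a₂ (x, y, t)) (a₂ (x, y, p)) p :=
      hasDerivAt_integral_right_of_continuousOn (g := fun t => a₂ (x, y, t)) hC hp₀ hp
        (ha₂.comp (by fun_prop) fun t ht => mem hx hy ht)
    exact h₂.const_add ((∫ t in x₀..x, a₀ (t, y₀, p₀)) + ∫ t in y₀..y, a₁ (x, t, p₀))

/-! ### Global potential and the equivalence -/

/-- Local potentials on a simply connected open set glue to a global one. -/
theorem IsSimplyConnected.exists_hasPartialsAt {R : Set (ℝ × ℝ × ℝ)} (hR : IsOpen R)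
    (hsc : IsSimplyConnected R) {a₂ a₁ a₀ : ℝ × ℝ × ℝ → ℝ}
    (hloc : ∀ q ∈ R, ∃ Ψ, ∀ᶠ z in 𝓝 q, HasPartialsAt Ψ a₂ a₁ a₀ z) :
    ∃ Ψ, ∀ q ∈ R, HasPartialsAt Ψ a₂ a₁ a₀ q := by
  have : SimplyConnectedSpace R := hsc.simplyConnectedSpace
  have : LocallyPathConnectedSpace R := hR.locallyPathConnectedSpace
  have hloc' : ∀ q : R, ∃ (Ψ : ℝ × ℝ × ℝ → ℝ) (V : Set (ℝ × ℝ × ℝ)),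
      (∀ z ∈ V, HasPartialsAt Ψ a₂ a₁ a₀ z) ∧ IsOpen V ∧ (q : ℝ × ℝ × ℝ) ∈ V := fun q => by
    obtain ⟨Ψ, hΨ⟩ := hloc q q.2
    exact ⟨Ψ, eventually_nhds_iff.1 hΨ⟩
  choose F V hF hVo hqV using hloc'
  obtain ⟨g, hg⟩ := exists_global_of_eventually_sub_eq (X := R)
    (fun i : R => (Subtype.val : R → ℝ × ℝ × ℝ) ⁻¹' V i)
    (fun i => (hVo i).preimage continuous_subtype_val) id hqV (fun i z => F i z) (by
      rintro i j x ⟨hi, hj⟩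
      have hev : ∀ᶠ z in 𝓝 (x : ℝ × ℝ × ℝ), (F i - F j) z = (F i - F j) x := by
        refine eventually_eq_of_hasPartialsAt_zero ?_
        filter_upwards [(hVo i).mem_nhds hi, (hVo j).mem_nhds hj] with z hzi hzj
        simpa only [sub_self] using (hF i z hzi).sub (hF j z hzj)
      exact continuous_subtype_val.continuousAt.eventually hev)
  classical
  refine ⟨fun q => if h : q ∈ R then g ⟨q, h⟩ else 0, fun q hq => ?_⟩
  refine (hF ⟨q, hq⟩ q (hqV ⟨q, hq⟩)).congr_of_eventually_sub_eq
    (c := g ⟨q, hq⟩ - F ⟨q, hq⟩ q) ?_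
  have hev := hg ⟨q, hq⟩ ⟨q, hq⟩ (hqV ⟨q, hq⟩)
  -- Since `R` is open, neighbourhoods in the subtype are neighbourhoods in the ambient space.
  rw [← hR.isOpenEmbedding_subtypeVal.map_nhds_eq ⟨q, hq⟩, eventually_map]
  filter_upwards [hev] with z hz
  simpa using hz

theorem partials_eq_of_hasPartialsAt {R : Set (ℝ × ℝ × ℝ)} (hR : IsOpen R)
    {Ψ a₂ a₁ a₀ : ℝ × ℝ × ℝ → ℝ} (hΨ : ∀ q ∈ R, HasPartialsAt Ψ a₂ a₁ a₀ q)
    (ha₂y : HasContPartialY a₂ R) (ha₂x : HasContPartialX a₂ R)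
    (ha₁x : HasContPartialX a₁ R) (ha₁p : HasContPartialP a₁ R)
    (ha₀p : HasContPartialP a₀ R) (ha₀y : HasContPartialY a₀ R) {q : ℝ × ℝ × ℝ} (hq : q ∈ R) :
    partialY a₂ q = partialP a₁ q ∧ partialX a₂ q = partialP a₀ q ∧
      partialX a₁ q = partialY a₀ q := by
  obtain ⟨x, y, p⟩ := q
  have hRq := hR.mem_nhds hq
  have comp : ∀ {f : ℝ × ℝ × ℝ → ℝ} {e : ℝ × ℝ → ℝ × ℝ × ℝ} {z : ℝ × ℝ}, ContinuousOn f R →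
      Continuous e → e z = (x, y, p) → ContinuousAt (fun w => f (e w)) z := by
    intro f e z hf he hez
    exact ContinuousAt.comp (g := f) (by rw [hez]; exact hf.continuousAt hRq) he.continuousAt
  have nhd : ∀ {e : ℝ × ℝ → ℝ × ℝ × ℝ} {z : ℝ × ℝ}, Continuous e → e z = (x, y, p) →
      e ⁻¹' R ∈ 𝓝 z := fun he hez => he.continuousAt.preimage_mem_nhds (by rwa [hez])
  -- Each identity freezes one variable of `Ψ` and is a planar statement in the other two.
  refine ⟨?_, ?_, ?_⟩
  · have he : Continuous fun z : ℝ × ℝ => (x, z.1, z.2) := by fun_prop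
    exact (mixed_partial_eq (f := fun u v => Ψ (x, u, v)) (fx := fun u v => a₁ (x, u, v))
      (fy := fun u v => a₂ (x, u, v)) (fxy := fun u v => partialP a₁ (x, u, v))
      (fyx := fun u v => partialY a₂ (x, u, v)) (nhd (z := (y, p)) he rfl)
      (fun u v h => (hΨ _ h).2.1) (fun u v h => (hΨ _ h).2.2)
      (fun u v h => ha₁p.hasDerivAt h) (fun u v h => ha₂y.hasDerivAt h)
      (comp ha₁p.2 he rfl) (comp ha₂y.2 he rfl)).symm
  · have he : Continuous fun z : ℝ × ℝ => (z.1, y, z.2) := by fun_prop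
    exact (mixed_partial_eq (f := fun u v => Ψ (u, y, v)) (fx := fun u v => a₀ (u, y, v))
      (fy := fun u v => a₂ (u, y, v)) (fxy := fun u v => partialP a₀ (u, y, v))
      (fyx := fun u v => partialX a₂ (u, y, v)) (nhd (z := (x, p)) he rfl)
      (fun u v h => (hΨ _ h).1) (fun u v h => (hΨ _ h).2.2)
      (fun u v h => ha₀p.hasDerivAt h) (fun u v h => ha₂x.hasDerivAt h)
      (comp ha₀p.2 he rfl) (comp ha₂x.2 he rfl)).symm
  · have he : Continuous fun z : ℝ × ℝ => (z.1, z.2, p) := by fun_prop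
    exact (mixed_partial_eq (f := fun u v => Ψ (u, v, p)) (fx := fun u v => a₀ (u, v, p))
      (fy := fun u v => a₁ (u, v, p)) (fxy := fun u v => partialY a₀ (u, v, p))
      (fyx := fun u v => partialX a₁ (u, v, p)) (nhd (z := (x, y)) he rfl)
      (fun u v h => (hΨ _ h).1) (fun u v h => (hΨ _ h).2.1)
      (fun u v h => ha₀y.hasDerivAt h) (fun u v h => ha₁x.hasDerivAt h)
      (comp ha₀y.2 he rfl) (comp ha₁x.2 he rfl)).symm

theorem theorem2p1 (R : Set (ℝ × ℝ × ℝ)) (hR_open : IsOpen R) (hR_sc : IsSimplyConnected R)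
    (a₂ a₁ a₀ : ℝ × ℝ × ℝ → ℝ)
    (ha₂ : ContinuousOn a₂ R) (ha₁ : ContinuousOn a₁ R) (ha₀ : ContinuousOn a₀ R)
    (ha₂y : HasContPartialY a₂ R) (ha₂x : HasContPartialX a₂ R)
    (ha₁x : HasContPartialX a₁ R) (ha₁p : HasContPartialP a₁ R)
    (ha₀p : HasContPartialP a₀ R) (ha₀y : HasContPartialY a₀ R) :
    IsExactEquationOn a₂ a₁ a₀ R ↔
      ∀ q ∈ R, partialY a₂ q = partialP a₁ q ∧
        partialX a₂ q = partialP a₀ q ∧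
        partialX a₁ q = partialY a₀ q := by
  constructor
  · rintro ⟨Ψ, hΨ⟩ q hq
    exact partials_eq_of_hasPartialsAt hR_open hΨ ha₂y ha₂x ha₁x ha₁p ha₀p ha₀y hq
  · intro hcl
    refine hR_sc.exists_hasPartialsAt hR_open fun q hq => ?_
    obtain ⟨δ, hδ, hball⟩ := Metric.isOpen_iff.1 hR_open q hq
    have hord : ∀ c : ℝ, (Metric.ball c δ).OrdConnected := fun c => (convex_ball c δ).ordConnected
    have := hord q.1
    have := hord q.2.1
    have := hord q.2.2
    obtain ⟨Ψ, hΨ⟩ := exists_hasPartialsAt_of_box Metric.isOpen_ball Metric.isOpen_ball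
      Metric.isOpen_ball (Metric.mem_ball_self hδ) (Metric.mem_ball_self hδ)
      (Metric.mem_ball_self hδ) (ball_eq_prod q δ ▸ hball) ha₂ ha₁ ha₀ ha₂y ha₂x ha₁x ha₁p
      ha₀p ha₀y hcl
    refine ⟨Ψ, ?_⟩
    filter_upwards [Metric.ball_mem_nhds q hδ] with z hz
    exact hΨ z (ball_eq_prod q δ ▸ hz)
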